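/- Let $\Phi_0$ be a reduced, irreducible, crystallographic finite root system spanning a Euclidean space $(V_0,B_0)$, with finite Weyl group $W_0$ (generated by the orthogonal reflections in the roots), a simple system $\Delta_0$, the corresponding positive roots $\Phi_0^+$, and highest root $\omega$. Let $V=V_0\oplus\mathbb R\delta$, let $B$ be the symmetric bilinear form on $V$ that extends $B_0$ and satisfies $B(\delta,\cdot)=0$, write $\|v\|=\sqrt{B(v,v)}$, and for $B(a,a)\ne 0$ let $s_a(v)=v-2\frac{B(v,a)}{B(a,a)}a$. Put $\Delta=\Delta_0\cup\{\delta-\omega\}$ and $S=\{s_a\mid a\in\Delta\}$, let $W$ be the (affine Weyl) group generated by $S$, with length function $\ell$ with respect to $S$, and let $$\Phi^+=\{k\delta+\alpha,\ (k+1)\delta-\alpha \mid \alpha\in\Phi_0^+,\ k\in\mathbb N\},\qquad \mathbb N=\{0,1,2,\dots\}.$$ For $\beta\in\Phi^+$ let $\operatorname{dp}(\beta)=\min\{\ell(w)\mid w\in W,\ w(\beta)\in\Delta\}$. The root poset $(\Phi^+,\le)$ is defined by: $\alpha\le\beta$ if and only if there is $w\in W$ with $w(\alpha)=\beta$ and $\ell(w)=\operatorname{dp}(\beta)-\operatorname{dp}(\alpha)$.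 A covering $\beta\lhd\gamma$ of the root poset is called short if $\gamma=s_a(\beta)$ for some $a\in\Delta$ with $-\|\beta\|\,\|a\|<B(\beta,a)<0$. Let $\mathcal O\subseteq\Phi_0$ be a $W_0$-orbit, let $\mathcal O^+=\mathcal O\cap\Phi_0^+$, and for $k\in\mathbb N$ let $$\Sigma_{\mathcal O,k}=\{k\delta+\alpha,\ (k+1)\delta-\alpha\mid\alpha\in\mathcal O^+\}\subseteq\Phi^+,\qquad \Sigma_{\mathcal O}=\Sigma_{\mathcal O,0},$$ with the orders induced by the root poset. Theorem. For every $W_0$-orbit $\mathcal O$ and every $k\in\mathbb N$, the map $$\pi_k:\Sigma_{\mathcal O,k}\to\Sigma_{\mathcal O},\qquad k\delta+\alpha\mapsto\alpha,\quad (k+1)\delta-\alpha\mapsto\delta-\alpha\qquad(\alpha\in\mathcal O^+)$$ is an isomorphism of posets. Moreover, every covering relation $\beta\lhd\gamma$ of the poset $\Sigma_{\mathcal O,k}$ is a covering relation of $(\Phi^+,\le)$ and is short. -/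

import Mathlib

open scoped RealInnerProductSpace

noncomputable section

namespace AffineRoot

section Space

variable {V₀ : Type*} [NormedAddCommGroup V₀] [InnerProductSpace ℝ V₀]

/-- The symmetric bilinear form `B` on `V = V₀ ⊕ ℝδ`, written as `V₀ × ℝ` with `δ = (0, 1)`: it
extends the inner product of `V₀` and has `δ` in its radical. -/
def form : LinearMap.BilinForm ℝ (V₀ × ℝ) :=
  (innerₗ V₀).compl₁₂ (LinearMap.fst ℝ V₀ ℝ) (LinearMap.fst ℝ V₀ ℝ)

@[simp]
theorem form_apply (x y : V₀ × ℝ) : form x y = ⟪x.1, y.1⟫ := rfl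

/-- The length `‖x‖ = √B(x, x)` of a vector of `V₀ ⊕ ℝδ`. -/
def len (x : V₀ × ℝ) : ℝ := √(form x x)

/-- The isotropic vector `δ`. -/
def delta : V₀ × ℝ := (0, 1)

/-- The inclusion `V₀ → V₀ ⊕ ℝδ`. -/
def incl (v : V₀) : V₀ × ℝ := (v, 0)

/-- The linear map `v ↦ v - 2 B(v, a) / B(a, a) • a`. -/
def reflLin (a : V₀ × ℝ) : (V₀ × ℝ) →ₗ[ℝ] (V₀ × ℝ) where
  toFun v := v - (2 * form v a / form a a) • a
  map_add' x y := by
    rw [map_add, LinearMap.add_apply, mul_add, add_div, add_smul]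
    abel
  map_smul' c x := by
    rw [map_smul, LinearMap.smul_apply, smul_eq_mul, RingHom.id_apply, smul_sub, smul_smul]
    congr 2
    ring

theorem reflLin_involutive (a : V₀ × ℝ) : Function.Involutive (reflLin a) := by
  intro v
  change (v - (2 * form v a / form a a) • a) -
    (2 * form (v - (2 * form v a / form a a) • a) a / form a a) • a = v
  rw [map_sub, map_smul, LinearMap.sub_apply, LinearMap.smul_apply, smul_eq_mul, sub_sub,
    ← add_smul]
  have h : 2 * form v a / form a a +
      2 * (form v a - 2 * form v a / form a a * form a a) / form a a = 0 := by
    by_cases h : form a a = 0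
    · rw [h]; simp
    · field_simp; ring
  rw [h, zero_smul, sub_zero]

/-- The orthogonal reflection `s_a` of `V₀ ⊕ ℝδ` in a non-isotropic vector `a`. -/
def refl (a : V₀ × ℝ) : (V₀ × ℝ) ≃ₗ[ℝ] (V₀ × ℝ) :=
  LinearEquiv.ofInvolutive (reflLin a) (reflLin_involutive a)

theorem refl_apply (a v : V₀ × ℝ) : refl a v = v - (2 * form v a / form a a) • a := rfl

theorem refl_mul_self (a : V₀ × ℝ) : refl a * refl a = 1 :=
  LinearEquiv.ext fun v => reflLin_involutive a v

end Space

variable {ι V₀ N : Type*} [NormedAddCommGroup V₀] [InnerProductSpace ℝ V₀]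
  [AddCommGroup N] [Module ℝ N] {P : RootPairing ι ℝ V₀ N}

/-- `ω` is (the index of) the highest root of the finite root system with respect to `b`: for
every root `β`, the difference `ω - β` is a sum of simple roots. -/
def IsHighestRoot (b : P.Base) (ω : ι) : Prop :=
  ∀ j, P.root ω - P.root j ∈ AddSubmonoid.closure (P.root '' b.support)

/-- The set `Φ₀⁺` of positive roots of the finite root system. -/
def finPosRoots (b : P.Base) : Set V₀ := P.root '' {i | b.IsPos i}

/-- The affine simple system `Δ = Δ₀ ∪ {δ - ω}`. -/
def simpleRoots (b : P.Base) (ω : ι) : Set (V₀ × ℝ) :=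
  (fun i => incl (P.root i)) '' b.support ∪ {delta - incl (P.root ω)}

/-- The affine Weyl group `W`, generated by the simple reflections `S = {s_a | a ∈ Δ}`. -/
def affWeyl (b : P.Base) (ω : ι) : Subgroup ((V₀ × ℝ) ≃ₗ[ℝ] (V₀ × ℝ)) :=
  Subgroup.closure (refl '' simpleRoots b ω)

/-- The length `ℓ(w)` of `w ∈ W`: the least length of a word in `S` that represents `w`. -/
def length (b : P.Base) (ω : ι) (w : affWeyl b ω) : ℕ :=
  sInf {n | ∃ l : List ((V₀ × ℝ) ≃ₗ[ℝ] (V₀ × ℝ)),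
    (∀ s ∈ l, s ∈ refl '' simpleRoots b ω) ∧ l.prod = w ∧ l.length = n}

/-- The depth `dp(β) = min {ℓ(w) | w ∈ W, w(β) ∈ Δ}`. -/
def depth (b : P.Base) (ω : ι) (β : V₀ × ℝ) : ℕ :=
  sInf {n | ∃ w : affWeyl b ω, w.1 β ∈ simpleRoots b ω ∧ length b ω w = n}

/-- The set `Φ⁺ = {kδ + α, (k+1)δ - α | α ∈ Φ₀⁺, k ∈ ℕ}` of positive affine roots. -/
def affPosRoots (b : P.Base) : Set (V₀ × ℝ) :=
  {v | ∃ k : ℕ, ∃ α ∈ finPosRoots b,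
    v = (k : ℝ) • delta + incl α ∨ v = ((k : ℝ) + 1) • delta - incl α}

/-- The type of positive affine roots, the carrier of the root poset. The highest root `ω` is
recorded in the type because the order depends on it. -/
def PosRoot (b : P.Base) (_ω : ι) : Type _ := {v : V₀ × ℝ // v ∈ affPosRoots b}

theorem exists_word (b : P.Base) (ω : ι) (w : affWeyl b ω) :
    ∃ l : List ((V₀ × ℝ) ≃ₗ[ℝ] (V₀ × ℝ)),
      (∀ s ∈ l, s ∈ refl '' simpleRoots b ω) ∧ l.prod = w ∧ l.length = length b ω w := by
  have hne : {n | ∃ l : List ((V₀ × ℝ) ≃ₗ[ℝ] (V₀ × ℝ)),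
      (∀ s ∈ l, s ∈ refl '' simpleRoots b ω) ∧ l.prod = w ∧ l.length = n}.Nonempty := by
    obtain ⟨w, hw⟩ := w
    have hinv : ∀ s ∈ refl '' simpleRoots b ω, s⁻¹ = s := by
      rintro _ ⟨a, -, rfl⟩
      exact (mul_eq_one_iff_eq_inv.mp (refl_mul_self a)).symm
    have hS : refl '' simpleRoots b ω ∪ (refl '' simpleRoots b ω)⁻¹ ⊆ refl '' simpleRoots b ω := by
      rintro s (hs | hs)
      · exact hs
      · have h := hinv _ hs
        rw [inv_inv] at h
        rw [h]
        exact hs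
    rw [affWeyl, ← Subgroup.mem_toSubmonoid, Subgroup.closure_toSubmonoid] at hw
    obtain ⟨l, hl, hp⟩ := Submonoid.exists_list_of_mem_closure hw
    exact ⟨l.length, l, fun s hs => hS (hl s hs), hp, rfl⟩
  exact Nat.sInf_mem hne

theorem length_one (b : P.Base) (ω : ι) : length b ω 1 = 0 :=
  Nat.sInf_eq_zero.mpr (Or.inl ⟨[], by simp, rfl, rfl⟩)

theorem eq_one_of_length_eq_zero (b : P.Base) (ω : ι) {w : affWeyl b ω}
    (h : length b ω w = 0) : w = 1 := by
  obtain ⟨l, -, hp, hl⟩ := exists_word b ω w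
  rw [h, List.length_eq_zero_iff] at hl
  subst hl
  exact Subtype.ext hp.symm

theorem length_mul_le (b : P.Base) (ω : ι) (u w : affWeyl b ω) :
    length b ω (u * w) ≤ length b ω u + length b ω w := by
  obtain ⟨l, hl, hp, hn⟩ := exists_word b ω u
  obtain ⟨l', hl', hp', hn'⟩ := exists_word b ω w
  refine Nat.sInf_le ⟨l ++ l', fun s hs => ?_, ?_, ?_⟩
  · exact (List.mem_append.mp hs).elim (hl s) (hl' s)
  · rw [List.prod_append, hp, hp']; rfl
  · rw [List.length_append, hn, hn']

theorem length_inv_le (b : P.Base) (ω : ι) (w : affWeyl b ω) :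
    length b ω w⁻¹ ≤ length b ω w := by
  obtain ⟨l, hl, hp, hn⟩ := exists_word b ω w
  have hmap : l.map (fun s => s⁻¹) = l := by
    conv_rhs => rw [← List.map_id l]
    refine List.map_congr_left fun s hs => ?_
    obtain ⟨a, -, rfl⟩ := hl s hs
    exact (mul_eq_one_iff_eq_inv.mp (refl_mul_self a)).symm
  refine Nat.sInf_le ⟨l.reverse, fun s hs => hl s (List.mem_reverse.mp hs), ?_, ?_⟩
  · rw [Subgroup.coe_inv, ← hp, List.prod_inv_reverse, hmap]
  · rw [List.length_reverse, hn]

theorem depth_apply_le (b : P.Base) (ω : ι) (w : affWeyl b ω) (β : V₀ × ℝ) :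
    depth b ω (w.1 β) ≤ depth b ω β + length b ω w := by
  by_cases h : {n | ∃ u : affWeyl b ω, u.1 β ∈ simpleRoots b ω ∧ length b ω u = n}.Nonempty
  · obtain ⟨u, hu, hn⟩ := Nat.sInf_mem h
    have hmem : (u * w⁻¹).1 (w.1 β) ∈ simpleRoots b ω := by
      have : (u * w⁻¹).1 (w.1 β) = u.1 β := congrArg u.1 (w.1.symm_apply_apply β)
      rwa [this]
    have h1 : depth b ω (w.1 β) ≤ length b ω (u * w⁻¹) := Nat.sInf_le ⟨u * w⁻¹, hmem, rfl⟩
    refine h1.trans ((length_mul_le b ω u w⁻¹).trans ?_)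
    exact add_le_add (le_of_eq hn) (length_inv_le b ω w)
  · have h0 : depth b ω (w.1 β) = 0 := by
      refine Nat.sInf_eq_zero.mpr (Or.inr (Set.not_nonempty_iff_eq_empty.mp fun h' => h ?_))
      obtain ⟨n, u, hu, -⟩ := h'
      exact ⟨length b ω (u * w), u * w, hu, rfl⟩
    rw [h0]
    exact Nat.zero_le _

/-- The root poset `(Φ⁺, ≤)`: `α ≤ β` if and only if there is `w ∈ W` with `w(α) = β` and
`ℓ(w) = dp(β) - dp(α)`. -/
instance (b : P.Base) (ω : ι) : PartialOrder (PosRoot b ω) where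
  le α β := ∃ w : affWeyl b ω, w.1 α.1 = β.1 ∧
    (length b ω w : ℤ) = (depth b ω β.1 : ℤ) - (depth b ω α.1 : ℤ)
  le_refl α := ⟨1, rfl, by rw [length_one]; simp⟩
  le_trans α β γ := by
    rintro ⟨u, hu, hu'⟩ ⟨w, hw, hw'⟩
    have h : (w * u).1 α.1 = γ.1 := by rw [← hw, ← hu]; rfl
    refine ⟨w * u, h, ?_⟩
    have h1 := length_mul_le b ω w u
    have h2 := depth_apply_le b ω (w * u) α.1
    rw [h] at h2
    omega
  le_antisymm α β := by
    rintro ⟨u, hu, hu'⟩ ⟨w, hw, hw'⟩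
    have h : u = 1 := eq_one_of_length_eq_zero b ω (by omega)
    rw [h] at hu
    exact Subtype.ext hu

/-- A covering `β ⋖ γ = s_a(β)`, `a ∈ Δ`, of the root poset is short if
`-‖β‖‖a‖ < B(β, a) < 0`. -/
def IsShortCovering {b : P.Base} {ω : ι} (β γ : PosRoot b ω) : Prop :=
  β ⋖ γ ∧ ∃ a ∈ simpleRoots b ω, refl a β.1 = γ.1 ∧
    -(len β.1 * len a) < form β.1 a ∧ form β.1 a < 0

/-- The positive part `O⁺ = O ∩ Φ₀⁺` of a set `O` of finite roots. -/
def posPart (b : P.Base) (O : Set V₀) : Set V₀ := O ∩ finPosRoots b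

/-- The slice `Σ_{O,k} = (kδ + O⁺) ⊔ ((k+1)δ - O⁺)`, with the order induced by the root poset. -/
def slice (b : P.Base) (ω : ι) (O : Set V₀) (k : ℕ) : Set (PosRoot b ω) :=
  {x | ∃ α ∈ posPart b O,
    x.1 = (k : ℝ) • delta + incl α ∨ x.1 = ((k : ℝ) + 1) • delta - incl α}

end AffineRoot

end

open scoped RealInnerProductSpace

/-! The root poset is generated by upward steps `β → s_a(β)` with `a ∈ Δ` and `B(β, a) < 0`
(`le_iff_reflTransGen`). Since `δ` lies in the radical of `B`, such steps commute with translation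
by multiples of `δ`, so translation by `-kδ` is an order isomorphism between slices.

To identify the order, depth is replaced by `signDepth`, the least length of a word changing the
sign of a root; on positive roots it is the depth plus one (`depth_add_one`). The key point
(`signDepth_refl_add_one`) is that reflecting a positive root `β ≠ a` with `B(β, a) > 0` lowers it
by exactly one. Depth therefore rises by one exactly along upward steps, and a word whose length
equals the depth gained consists of such steps only. The argument needs only the axioms
`IsSimpleSystem`, checked for `Δ` by means of a linear height equal to `1` on all of `Δ`.

For coverings, put `h = ht(ω) + 1`, the height of `δ`. The slice `k` consists of the positive roots
with finite part in `O` and height strictly between `kh` and `(k+1)h` (`mem_slice_iff`). Upward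
steps raise the height and preserve `O`, so slices are order-convex: a covering in a slice is a
covering of the whole poset, hence a single upward step. If it were not short, the finite parts of
`β` and `a` would be opposite, so `β + a` would be a multiple of `δ` of height strictly between `kh`
and `(k+1)h`, which is impossible. -/

namespace AffineRoot

/-! ### Abstract simple systems, sign depth and upward steps -/

section Core

variable {V₀ : Type*} [NormedAddCommGroup V₀] [InnerProductSpace ℝ V₀]

/-- A set `Δ` of simple roots in a set `R` of (real) roots, positivity of roots being recorded by
the sign of a height function `H`. -/
structure IsSimpleSystem (Δ R : Set (V₀ × ℝ)) (H : (V₀ × ℝ) →ₗ[ℝ] ℝ) : Prop where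
  subset : Δ ⊆ R
  neg_mem : ∀ β ∈ R, -β ∈ R
  refl_mem : ∀ a ∈ Δ, ∀ β ∈ R, refl a β ∈ R
  form_self_pos : ∀ a ∈ Δ, 0 < form a a
  height_simple : ∀ a ∈ Δ, H a = 1
  height_int : ∀ β ∈ R, ∃ z : ℤ, H β = z
  height_ne_zero : ∀ β ∈ R, H β ≠ 0
  height_refl_pos : ∀ a ∈ Δ, ∀ β ∈ R, 0 < H β → β ≠ a → 0 < H (refl a β)
  exists_form_pos : ∀ β ∈ R, 0 < H β → ∃ a ∈ Δ, 0 < form β a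

/-- The product of the reflections in the entries of a list. -/
noncomputable def word (l : List (V₀ × ℝ)) : (V₀ × ℝ) ≃ₗ[ℝ] (V₀ × ℝ) := (l.map refl).prod

@[simp] theorem word_nil (v : V₀ × ℝ) : word [] v = v := rfl

@[simp] theorem word_cons (a : V₀ × ℝ) (l : List (V₀ × ℝ)) (v : V₀ × ℝ) :
    word (a :: l) v = refl a (word l v) := rfl

theorem word_append (l l' : List (V₀ × ℝ)) (v : V₀ × ℝ) :
    word (l ++ l') v = word l (word l' v) := by
  simp [word, LinearEquiv.mul_apply]

@[simp] theorem refl_refl (a v : V₀ × ℝ) : refl a (refl a v) = v := reflLin_involutive a v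

theorem form_comm (x y : V₀ × ℝ) : form x y = form y x := real_inner_comm _ _

theorem form_refl_refl {a : V₀ × ℝ} (x y : V₀ × ℝ) : form (refl a x) (refl a y) = form x y := by
  simp only [refl_apply, map_sub, map_smul, LinearMap.sub_apply, LinearMap.smul_apply, smul_eq_mul]
  rw [form_comm a y]
  by_cases h : form a a = 0
  · simp [h]
  · field_simp
    ring

theorem form_word_word (l : List (V₀ × ℝ)) (x y : V₀ × ℝ) :
    form (word l x) (word l y) = form x y := by
  induction l with
  | nil => rfl
  | cons a l ih => rw [word_cons, word_cons, form_refl_refl, ih]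

theorem form_refl_self {a : V₀ × ℝ} (ha : form a a ≠ 0) (x : V₀ × ℝ) :
    form (refl a x) a = -form x a := by
  simp only [refl_apply, map_sub, map_smul, LinearMap.sub_apply, LinearMap.smul_apply, smul_eq_mul]
  field_simp
  ring

theorem refl_self {a : V₀ × ℝ} (ha : form a a ≠ 0) : refl a a = -a := by
  rw [refl_apply, mul_div_assoc, div_self ha, mul_one, two_smul]
  abel

theorem refl_word (l : List (V₀ × ℝ)) (a v : V₀ × ℝ) :
    refl (word l a) (word l v) = word l (refl a v) := by
  simp only [refl_apply, form_word_word, map_sub, map_smul]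

/-- The least length of a word in the reflections of `Δ` that changes the sign of the height
of `β`. -/
noncomputable def signDepth (Δ : Set (V₀ × ℝ)) (H : (V₀ × ℝ) →ₗ[ℝ] ℝ) (β : V₀ × ℝ) : ℕ :=
  sInf {n | ∃ l : List (V₀ × ℝ), (∀ a ∈ l, a ∈ Δ) ∧ H (word l β) * H β < 0 ∧ l.length = n}

theorem signDepth_neg (Δ : Set (V₀ × ℝ)) (H : (V₀ × ℝ) →ₗ[ℝ] ℝ) (β : V₀ × ℝ) :
    signDepth Δ H (-β) = signDepth Δ H β := by
  simp [signDepth]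

theorem signDepth_le {Δ : Set (V₀ × ℝ)} {H : (V₀ × ℝ) →ₗ[ℝ] ℝ} {β : V₀ × ℝ}
    {l : List (V₀ × ℝ)} (hl : ∀ a ∈ l, a ∈ Δ) (h : H (word l β) * H β < 0) :
    signDepth Δ H β ≤ l.length :=
  Nat.sInf_le ⟨l, hl, h, rfl⟩

/-- An upward step `β → s_a(β)`, `B(β, a) < 0`, along a simple root. -/
def Up (Δ : Set (V₀ × ℝ)) (β γ : V₀ × ℝ) : Prop := ∃ a ∈ Δ, form β a < 0 ∧ γ = refl a β

/-- Pairings with `a` ignore multiples of `δ`; this is the source of the isomorphism between slices.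
-/
theorem Up.add_smul_delta {Δ : Set (V₀ × ℝ)} {β γ : V₀ × ℝ} (h : Up Δ β γ) (t : ℝ) :
    Up Δ (β + t • delta) (γ + t • delta) := by
  obtain ⟨a, ha, hn, rfl⟩ := h
  have hf : form (β + t • delta) a = form β a := by simp [delta]
  refine ⟨a, ha, by rwa [hf], ?_⟩
  rw [refl_apply, refl_apply, hf]
  abel

theorem reflTransGen_add_smul_delta {Δ : Set (V₀ × ℝ)} {β γ : V₀ × ℝ}
    (h : Relation.ReflTransGen (Up Δ) β γ) (t : ℝ) :
    Relation.ReflTransGen (Up Δ) (β + t • delta) (γ + t • delta) := by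
  induction h with
  | refl => exact Relation.ReflTransGen.refl
  | tail _ hu ih => exact ih.tail (hu.add_smul_delta t)

namespace IsSimpleSystem

variable {Δ R : Set (V₀ × ℝ)} {H : (V₀ × ℝ) →ₗ[ℝ] ℝ} (hS : IsSimpleSystem Δ R H)

include hS

theorem word_mem {l : List (V₀ × ℝ)} (hl : ∀ a ∈ l, a ∈ Δ) {β : V₀ × ℝ} (hβ : β ∈ R) :
    word l β ∈ R := by
  induction l with
  | nil => exact hβ
  | cons a l ih =>
    exact hS.refl_mem a (hl a List.mem_cons_self) _ (ih fun c hc => hl c (List.mem_cons_of_mem _ hc))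

theorem height_neg_of_not_pos {β : V₀ × ℝ} (hβ : β ∈ R) (h : ¬ 0 < H β) : H β < 0 :=
  lt_of_le_of_ne (not_lt.mp h) (hS.height_ne_zero β hβ)

theorem eq_of_height_refl_neg {a β : V₀ × ℝ} (ha : a ∈ Δ) (hβ : β ∈ R) (hp : 0 < H β)
    (h : H (refl a β) < 0) : β = a := by
  by_contra hne
  exact absurd (hS.height_refl_pos a ha β hβ hp hne) (not_lt.mpr h.le)

theorem height_refl {a : V₀ × ℝ} (ha : a ∈ Δ) (β : V₀ × ℝ) :
    H (refl a β) = H β - 2 * form β a / form a a := by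
  rw [refl_apply, map_sub, map_smul, hS.height_simple a ha, smul_eq_mul, mul_one]

/-- The exchange property. -/
theorem exists_word_mul_refl {a : V₀ × ℝ} (ha : a ∈ Δ) {l : List (V₀ × ℝ)}
    (hl : ∀ c ∈ l, c ∈ Δ) (h : H (word l a) < 0) :
    ∃ l' : List (V₀ × ℝ), (∀ c ∈ l', c ∈ Δ) ∧ l'.length + 1 = l.length ∧
      ∀ v, word l' v = word l (refl a v) := by
  induction l with
  | nil =>
    rw [word_nil, hS.height_simple a ha] at h
    linarith
  | cons c l ih =>
    have hc := hl c List.mem_cons_self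
    have hl' : ∀ c ∈ l, c ∈ Δ := fun d hd => hl d (List.mem_cons_of_mem _ hd)
    -- If `c` is the letter that makes the image of `a` negative, then `word l a = c`, so `s_c` is
    -- the conjugate of `s_a` by `word l`, and deleting `c` multiplies by `s_a` on the right.
    by_cases hp : 0 < H (word l a)
    · have he := hS.eq_of_height_refl_neg hc (hS.word_mem hl' (hS.subset ha)) hp h
      refine ⟨l, hl', rfl, fun v => ?_⟩
      rw [word_cons, ← he, refl_word, refl_refl]
    · obtain ⟨l'', h1, h2, h3⟩ := ih hl' (hS.height_neg_of_not_pos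
        (hS.word_mem hl' (hS.subset ha)) hp)
      refine ⟨c :: l'', ?_, by simp [h2], fun v => by simp [h3]⟩
      intro d hd
      rcases List.mem_cons.mp hd with rfl | hd
      exacts [hc, h1 d hd]

/-- Induction on the integer height: reflecting in a simple root that pairs positively lowers it. It
guarantees that the infimum in `signDepth` is not over the empty set. -/
theorem exists_word_pos {β : V₀ × ℝ} (hβ : β ∈ R) (hp : 0 < H β) :
    ∃ l : List (V₀ × ℝ), (∀ a ∈ l, a ∈ Δ) ∧ H (word l β) < 0 := by
  obtain ⟨z, hz⟩ := hS.height_int β hβ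
  obtain ⟨n, rfl⟩ : ∃ n : ℕ, z = n := by
    refine Int.eq_ofNat_of_zero_le ?_
    rw [hz] at hp
    exact_mod_cast hp.le
  induction n using Nat.strong_induction_on generalizing β with
  | _ n ih =>
    obtain ⟨a, ha, hf⟩ := hS.exists_form_pos β hβ hp
    by_cases hne : β = a
    · subst hne
      refine ⟨[β], by simpa using ha, ?_⟩
      rw [word_cons, word_nil, refl_self hf.ne', map_neg]
      linarith
    · have hp' := hS.height_refl_pos a ha β hβ hp hne
      have hR := hS.refl_mem a ha β hβ
      obtain ⟨m, hm⟩ := hS.height_int _ hR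
      obtain ⟨m, rfl⟩ : ∃ k : ℕ, m = k := by
        refine Int.eq_ofNat_of_zero_le ?_
        rw [hm] at hp'
        exact_mod_cast hp'.le
      have hlt : H (refl a β) < H β := by
        rw [hS.height_refl ha]
        have := div_pos (mul_pos two_pos hf) (hS.form_self_pos a ha)
        linarith
      rw [hm, hz] at hlt
      obtain ⟨l, hl, hw⟩ := ih m (by exact_mod_cast hlt) hR hp' hm
      refine ⟨l ++ [a], ?_, by simpa [word_append] using hw⟩
      intro c hc
      rcases List.mem_append.mp hc with hc | hc
      · exact hl c hc
      · rwa [List.mem_singleton.mp hc]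

theorem exists_word_signDepth {β : V₀ × ℝ} (hβ : β ∈ R) :
    ∃ l : List (V₀ × ℝ), (∀ a ∈ l, a ∈ Δ) ∧ H (word l β) * H β < 0 ∧
      l.length = signDepth Δ H β := by
  refine Nat.sInf_mem (s := {n | ∃ l : List (V₀ × ℝ), (∀ a ∈ l, a ∈ Δ) ∧
    H (word l β) * H β < 0 ∧ l.length = n}) ?_
  by_cases hp : 0 < H β
  · obtain ⟨l, hl, h⟩ := hS.exists_word_pos hβ hp
    exact ⟨_, l, hl, mul_neg_of_neg_of_pos h hp, rfl⟩
  · have hn := hS.height_neg_of_not_pos hβ hp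
    obtain ⟨l, hl, h⟩ := hS.exists_word_pos (hS.neg_mem β hβ) (by rw [map_neg]; linarith)
    rw [map_neg, map_neg] at h
    exact ⟨_, l, hl, mul_neg_of_pos_of_neg (by linarith) hn, rfl⟩

/-- A shortest word that makes a positive root negative ends in a simple root. -/
theorem exists_cons_word_signDepth {β : V₀ × ℝ} (hβ : β ∈ R) (hp : 0 < H β) :
    ∃ c ∈ Δ, ∃ l : List (V₀ × ℝ), (∀ a ∈ l, a ∈ Δ) ∧ word l β = c ∧
      l.length + 1 = signDepth Δ H β := by
  obtain ⟨l, hl, hw, hn⟩ := hS.exists_word_signDepth hβ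
  replace hw : H (word l β) < 0 := by
    by_contra h
    exact absurd hw (not_lt.mpr (mul_nonneg (not_lt.mp h) hp.le))
  cases l with
  | nil => exact absurd hw (not_lt.mpr hp.le)
  | cons c l =>
    have hc := hl c List.mem_cons_self
    have hl' : ∀ c ∈ l, c ∈ Δ := fun d hd => hl d (List.mem_cons_of_mem _ hd)
    refine ⟨c, hc, l, hl', ?_, hn⟩
    refine hS.eq_of_height_refl_neg hc (hS.word_mem hl' hβ) ?_ hw
    by_contra hneg
    have := signDepth_le hl' (mul_neg_of_neg_of_pos
      (hS.height_neg_of_not_pos (hS.word_mem hl' hβ) hneg) hp)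
    rw [List.length_cons] at hn
    omega

theorem signDepth_le_refl {a β : V₀ × ℝ} (ha : a ∈ Δ) (hβ : β ∈ R) :
    signDepth Δ H β ≤ signDepth Δ H (refl a β) + 1 := by
  obtain ⟨l, hl, hw, hn⟩ := hS.exists_word_signDepth (hS.refl_mem a ha β hβ)
  -- If `s_a` preserves the sign, append `a` to a shortest word for `s_a(β)`; otherwise the word
  -- `[a]` already flips `β`.
  by_cases hs : 0 < H (refl a β) * H β
  · have hl' : ∀ c ∈ l ++ [a], c ∈ Δ := by
      intro c hc
      rcases List.mem_append.mp hc with hc | hc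
      · exact hl c hc
      · rwa [List.mem_singleton.mp hc]
    have hw' : H (word (l ++ [a]) β) * H β < 0 := by
      rw [word_append, word_cons, word_nil]
      rcases mul_neg_iff.mp hw with ⟨h1, h2⟩ | ⟨h1, h2⟩ <;>
        rcases mul_pos_iff.mp hs with ⟨h3, h4⟩ | ⟨h3, h4⟩
      · linarith
      · exact mul_neg_of_pos_of_neg h1 h4
      · exact mul_neg_of_neg_of_pos h1 h4
      · linarith
    have := signDepth_le hl' hw'
    rwa [List.length_append, hn] at this
  · have hs' : H (word [a] β) * H β < 0 := lt_of_le_of_ne (not_lt.mp hs)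
      (mul_ne_zero (hS.height_ne_zero _ (hS.refl_mem a ha β hβ)) (hS.height_ne_zero _ hβ))
    have := signDepth_le (Δ := Δ) (by simpa using ha) hs'
    rw [List.length_singleton] at this
    omega

theorem signDepth_refl_le {a β : V₀ × ℝ} (ha : a ∈ Δ) (hβ : β ∈ R) :
    signDepth Δ H (refl a β) ≤ signDepth Δ H β + 1 := by
  simpa using hS.signDepth_le_refl ha (hS.refl_mem a ha β hβ)

/-- A shortest word `w = c :: l` making `β` negative sends `β` to `-c`. A word shorter by one letter
that makes `s_a(β)` negative is found according to the sign of `w(a)`. -/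
theorem signDepth_refl_add_one {a β : V₀ × ℝ} (ha : a ∈ Δ) (hβ : β ∈ R) (hp : 0 < H β)
    (hne : β ≠ a) (hf : 0 < form β a) :
    signDepth Δ H (refl a β) + 1 = signDepth Δ H β := by
  refine le_antisymm ?_ (hS.signDepth_le_refl ha hβ)
  have hp' := hS.height_refl_pos a ha β hβ hp hne
  have haa := hS.form_self_pos a ha
  obtain ⟨c, hc, l, hl, hlc, hn⟩ := hS.exists_cons_word_signDepth hβ hp
  have hcl : ∀ d ∈ c :: l, d ∈ Δ := by
    intro d hd
    rcases List.mem_cons.mp hd with rfl | hd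
    exacts [hc, hl d hd]
  have hcβ : word (c :: l) β = -c := by
    rw [word_cons, hlc, refl_self (hS.form_self_pos c hc).ne']
  -- If `w(a)` is positive, `w(s_a β) = -(c + k w(a))` is the negative of a positive root other than
  -- `c`. Undoing `s_c` keeps it negative, so `l` suffices.
  by_cases hw : 0 < H (word (c :: l) a)
  · set k := 2 * form β a / form a a with hk
    have hkpos : 0 < k := div_pos (mul_pos two_pos hf) haa
    have he : word (c :: l) (refl a β) = -(c + k • word (c :: l) a) := by
      rw [refl_apply, map_sub, map_smul, hcβ]
      abel
    have hmem : c + k • word (c :: l) a ∈ R := by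
      have := hS.neg_mem _ (hS.word_mem hcl (hS.refl_mem a ha β hβ))
      rwa [he, neg_neg] at this
    have hpos : 0 < H (c + k • word (c :: l) a) := by
      rw [map_add, map_smul, smul_eq_mul, hS.height_simple c hc]
      have := mul_pos hkpos hw
      linarith
    have hnec : c + k • word (c :: l) a ≠ c := by
      intro h
      rw [add_eq_left, smul_eq_zero_iff_right hkpos.ne'] at h
      rw [h, map_zero] at hw
      exact lt_irrefl _ hw
    have := hS.height_refl_pos c hc _ hmem hpos hnec
    have hwl : word l (refl a β) = -refl c (c + k • word (c :: l) a) := by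
      rw [← map_neg, ← he, word_cons, refl_refl]
    have := signDepth_le (H := H) (β := refl a β) hl (mul_neg_of_neg_of_pos
      (by rw [hwl, map_neg]; linarith) hp')
    omega
  -- If `w(a)` is negative, exchange gives a word for `w s_a` with one letter fewer, and it sends
  -- `s_a(β)` to `w(β) = -c`.
  · obtain ⟨l', hl', hn', hw'⟩ := hS.exists_word_mul_refl ha hcl
      (hS.height_neg_of_not_pos (hS.word_mem hcl (hS.subset ha)) hw)
    have := signDepth_le (H := H) (β := refl a β) hl' (mul_neg_of_neg_of_pos
      (by rw [hw', refl_refl, hcβ, map_neg, hS.height_simple c hc]; linarith) hp')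
    rw [List.length_cons] at hn'
    omega

theorem ne_of_form_neg {a β : V₀ × ℝ} (ha : a ∈ Δ) (hf : form β a < 0) : β ≠ a := by
  rintro rfl
  exact absurd (hS.form_self_pos β ha) (not_lt.mpr hf.le)

theorem up_mem_pos {β γ : V₀ × ℝ} (h : Up Δ β γ) (hβ : β ∈ R) (hp : 0 < H β) :
    γ ∈ R ∧ 0 < H γ := by
  obtain ⟨a, ha, hf, rfl⟩ := h
  exact ⟨hS.refl_mem a ha β hβ, hS.height_refl_pos a ha β hβ hp (hS.ne_of_form_neg ha hf)⟩

theorem reflTransGen_mem_pos {β γ : V₀ × ℝ} (h : Relation.ReflTransGen (Up Δ) β γ) (hβ : β ∈ R)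
    (hp : 0 < H β) : γ ∈ R ∧ 0 < H γ := by
  induction h with
  | refl => exact ⟨hβ, hp⟩
  | tail _ hu ih => exact hS.up_mem_pos hu ih.1 ih.2

theorem signDepth_up {a β : V₀ × ℝ} (ha : a ∈ Δ) (hβ : β ∈ R) (hp : 0 < H β)
    (hf : form β a < 0) : signDepth Δ H (refl a β) = signDepth Δ H β + 1 := by
  have h := hS.up_mem_pos ⟨a, ha, hf, rfl⟩ hβ hp
  have hf' : 0 < form (refl a β) a := by
    rw [form_refl_self (hS.form_self_pos a ha).ne']
    linarith
  have hne : refl a β ≠ a := by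
    intro he
    have h1 : β = -a := by
      rw [← refl_refl a β, he, refl_self (hS.form_self_pos a ha).ne']
    rw [h1, map_neg, hS.height_simple a ha] at hp
    linarith
  simpa using (hS.signDepth_refl_add_one ha h.1 h.2 hne hf').symm

theorem height_lt_of_up {β γ : V₀ × ℝ} (h : Up Δ β γ) : H β < H γ := by
  obtain ⟨a, ha, hf, rfl⟩ := h
  rw [hS.height_refl ha]
  have := div_neg_of_neg_of_pos (by linarith : 2 * form β a < 0) (hS.form_self_pos a ha)
  linarith

theorem height_le_of_reflTransGen {β γ : V₀ × ℝ} (h : Relation.ReflTransGen (Up Δ) β γ) :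
    H β ≤ H γ := by
  induction h with
  | refl => exact le_rfl
  | tail _ hu ih => exact ih.trans (hS.height_lt_of_up hu).le

theorem signDepth_word_le {l : List (V₀ × ℝ)} (hl : ∀ a ∈ l, a ∈ Δ) {β : V₀ × ℝ}
    (hβ : β ∈ R) : signDepth Δ H (word l β) ≤ signDepth Δ H β + l.length := by
  induction l with
  | nil => simp
  | cons a l ih =>
    have hl' : ∀ c ∈ l, c ∈ Δ := fun d hd => hl d (List.mem_cons_of_mem _ hd)
    have h1 := ih hl'
    have h2 := hS.signDepth_refl_le (hl a List.mem_cons_self) (hS.word_mem hl' hβ)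
    rw [word_cons, List.length_cons]
    omega

/-- A word along which the depth grows as fast as possible is a sequence of upward steps. -/
theorem reflTransGen_of_signDepth_word {l : List (V₀ × ℝ)} (hl : ∀ a ∈ l, a ∈ Δ)
    {β : V₀ × ℝ} (hβ : β ∈ R) (hp : 0 < H (word l β))
    (h : signDepth Δ H (word l β) = signDepth Δ H β + l.length) :
    Relation.ReflTransGen (Up Δ) β (word l β) := by
  induction l with
  | nil => exact Relation.ReflTransGen.refl
  | cons a l ih =>
    have ha := hl a List.mem_cons_self
    have hl' : ∀ c ∈ l, c ∈ Δ := fun d hd => hl d (List.mem_cons_of_mem _ hd)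
    have hR := hS.word_mem hl' hβ
    have haa := (hS.form_self_pos a ha).ne'
    have h1 := hS.signDepth_word_le hl' hβ
    have h2 := hS.signDepth_refl_le ha hR
    rw [word_cons] at hp h ⊢
    rw [List.length_cons] at h
    -- Only `±a` change sign under `s_a`, so a negative `word l β` would be `-a`; it would then be
    -- negated, leaving `signDepth` unchanged instead of raised.
    have hpos : 0 < H (word l β) := by
      by_contra hneg
      have hneg := hS.height_neg_of_not_pos hR hneg
      have he : -word l β = a := by
        refine hS.eq_of_height_refl_neg ha (hS.neg_mem _ hR) (by rw [map_neg]; linarith) ?_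
        rw [map_neg, map_neg]
        linarith
      have hs : refl a (word l β) = -word l β := by
        conv_lhs => rw [← neg_neg (word l β), map_neg, he, refl_self haa, neg_neg, ← he]
      rw [hs, signDepth_neg] at h
      omega
    refine (ih hl' hpos (by omega)).tail ⟨a, ha, ?_, rfl⟩
    -- A zero pairing fixes the root and a positive one lowers its depth, so neither is compatible
    -- with growth.
    by_contra hf
    rcases (not_lt.mp hf).eq_or_lt with hf | hf
    · have hs : refl a (word l β) = word l β := by simp [refl_apply, ← hf]
      rw [hs] at h
      omega
    · have hne : word l β ≠ a := by
        intro he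
        rw [he, refl_self haa, map_neg, hS.height_simple a ha] at hp
        linarith
      have := hS.signDepth_refl_add_one ha hR hpos hne hf
      omega

end IsSimpleSystem

end Core

/-! ### The affine simple roots form a simple system -/

section AffineSystem

variable {ι V₀ N : Type*} [NormedAddCommGroup V₀] [InnerProductSpace ℝ V₀]
  [AddCommGroup N] [Module ℝ N] {P : RootPairing ι ℝ V₀ N}

theorem coroot'_mul_inner_self
    (hP : ∀ (i : ι) (x y : V₀), inner ℝ (P.reflection i x) (P.reflection i y) = inner ℝ x y)
    (i : ι) (x : V₀) : P.coroot' i x * ⟪P.root i, P.root i⟫ = 2 * ⟪x, P.root i⟫ := by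
  have h := hP i x (P.root i)
  rw [P.reflection_apply_self, P.reflection_apply, inner_neg_right, inner_sub_left,
    real_inner_smul_left] at h
  linarith

theorem inner_root_self_pos (i : ι) : 0 < ⟪P.root i, P.root i⟫ :=
  real_inner_self_pos.mpr (P.ne_zero i)

theorem coroot'_eq
    (hP : ∀ (i : ι) (x y : V₀), inner ℝ (P.reflection i x) (P.reflection i y) = inner ℝ x y)
    (i : ι) (x : V₀) : 2 * ⟪x, P.root i⟫ / ⟪P.root i, P.root i⟫ = P.coroot' i x := by
  rw [div_eq_iff (inner_root_self_pos i).ne', coroot'_mul_inner_self hP]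

theorem refl_incl
    (hP : ∀ (i : ι) (x y : V₀), inner ℝ (P.reflection i x) (P.reflection i y) = inner ℝ x y)
    (i : ι) (v : V₀ × ℝ) : refl (incl (P.root i)) v = (P.reflection i v.1, v.2) := by
  have h := coroot'_eq hP i v.1
  ext
  · simp only [refl_apply, form_apply, incl, Prod.fst_sub, Prod.smul_fst, h]
    rw [P.reflection_apply]
  · simp [refl_apply, incl]

theorem refl_delta_sub_incl
    (hP : ∀ (i : ι) (x y : V₀), inner ℝ (P.reflection i x) (P.reflection i y) = inner ℝ x y)
    (i : ι) (v : V₀ × ℝ) : refl (delta - incl (P.root i)) v =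
      (P.reflection i v.1, v.2 + P.coroot' i v.1) := by
  have h := coroot'_eq hP i v.1
  have h' : 2 * form v (delta - incl (P.root i)) /
      form (delta - incl (P.root i)) (delta - incl (P.root i)) = -P.coroot' i v.1 := by
    rw [← h]
    simp [delta, incl, neg_div]
  rw [refl_apply, h']
  ext
  · simp [delta, incl, P.reflection_apply]
  · simp [delta, incl]

theorem simpleRoots_cases {b : P.Base} {ω : ι} {a : V₀ × ℝ} (ha : a ∈ simpleRoots b ω) :
    (∃ i ∈ b.support, a = incl (P.root i)) ∨ a = delta - incl (P.root ω) := by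
  rcases ha with ⟨i, hi, rfl⟩ | ha
  · exact Or.inl ⟨i, hi, rfl⟩
  · exact Or.inr ha

/-- The first coordinate of a simple reflection is a finite reflection. -/
theorem exists_refl_fst
    (hP : ∀ (i : ι) (x y : V₀), inner ℝ (P.reflection i x) (P.reflection i y) = inner ℝ x y)
    {b : P.Base} {ω : ι} {a : V₀ × ℝ} (ha : a ∈ simpleRoots b ω) :
    ∃ i, ∀ v, (refl a v).1 = P.reflection i v.1 := by
  rcases simpleRoots_cases ha with ⟨i, -, rfl⟩ | rfl
  · exact ⟨i, fun v => by rw [refl_incl hP]⟩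
  · exact ⟨ω, fun v => by rw [refl_delta_sub_incl hP]⟩

/-- The set of all real affine roots `nδ + α`. -/
def affRoots (P : RootPairing ι ℝ V₀ N) : Set (V₀ × ℝ) :=
  {v | v.1 ∈ Set.range P.root ∧ ∃ n : ℤ, v.2 = n}

theorem inner_nonneg_of_mem_closure {b : P.Base} {x y : V₀}
    (hx : x ∈ AddSubmonoid.closure (P.root '' b.support))
    (hy : ∀ i ∈ b.support, 0 ≤ ⟪P.root i, y⟫) : 0 ≤ ⟪x, y⟫ := by
  induction hx using AddSubmonoid.closure_induction with
  | mem x hx =>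
    obtain ⟨i, hi, rfl⟩ := hx
    exact hy i hi
  | zero => simp
  | add x y _ _ ihx ihy =>
    rw [inner_add_left]
    exact add_nonneg ihx ihy

theorem exists_root_neg (i : ι) : ∃ j, P.root j = -P.root i :=
  ⟨P.reflectionPerm i i, by rw [P.root_reflectionPerm, P.reflection_apply_self]⟩

theorem exists_int_coroot' [P.IsCrystallographic] (i j : ι) : ∃ z : ℤ, P.coroot' i (P.root j) = z :=
  ⟨P.pairingIn ℤ j i, (P.algebraMap_pairingIn ℤ j i).symm⟩

variable [P.IsRootSystem]

/-- The linear height function of the finite root system. -/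
noncomputable def heightLin (b : P.Base) : V₀ →ₗ[ℝ] ℝ := b.toWeightBasis.constr ℝ fun _ => 1

theorem heightLin_simple {b : P.Base} {i : ι} (hi : i ∈ b.support) :
    heightLin b (P.root i) = 1 := by
  have := b.toWeightBasis.constr_basis ℝ (fun _ => (1 : ℝ)) ⟨i, hi⟩
  rwa [b.toWeightBasis_apply] at this

theorem heightLin_root (b : P.Base) (i : ι) : heightLin b (P.root i) = b.height i := by
  obtain ⟨f, -, -, hf⟩ := b.exists_root_eq_sum_int i
  rw [b.height_eq_sum hf, hf, map_sum, Int.cast_sum]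
  refine Finset.sum_congr rfl fun j hj => ?_
  rw [map_zsmul, heightLin_simple hj]
  simp

theorem isPos_iff_heightLin {b : P.Base} {i : ι} : b.IsPos i ↔ 0 < heightLin b (P.root i) := by
  rw [heightLin_root, b.isPos_iff, Int.cast_pos]

theorem heightLin_root_ne_zero (b : P.Base) (i : ι) : heightLin b (P.root i) ≠ 0 := by
  rw [heightLin_root]
  exact_mod_cast b.height_ne_zero i

theorem heightLin_nonneg {b : P.Base} {x : V₀}
    (hx : x ∈ AddSubmonoid.closure (P.root '' b.support)) :
    0 ≤ heightLin b x ∧ (heightLin b x = 0 → x = 0) := by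
  induction hx using AddSubmonoid.closure_induction with
  | mem x hx =>
    obtain ⟨i, hi, rfl⟩ := hx
    rw [heightLin_simple hi]
    norm_num
  | zero => simp
  | add x y _ _ ihx ihy =>
    rw [map_add]
    refine ⟨add_nonneg ihx.1 ihy.1, fun h => ?_⟩
    rw [ihx.2 (by linarith [ihx.1, ihy.1]), ihy.2 (by linarith [ihx.1, ihy.1]), add_zero]

theorem root_mem_closure_of_pos {b : P.Base} {i : ι} (h : 0 < heightLin b (P.root i)) :
    P.root i ∈ AddSubmonoid.closure (P.root '' b.support) := by
  rcases b.root_mem_or_neg_mem i with hi | hi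
  · exact hi
  · have := (heightLin_nonneg hi).1
    rw [map_neg] at this
    linarith

/-- The height function on `V₀ ⊕ ℝδ`, equal to `1` on every affine simple root. -/
noncomputable def affHeight (b : P.Base) (ω : ι) : (V₀ × ℝ) →ₗ[ℝ] ℝ :=
  (heightLin b).comp (LinearMap.fst ℝ V₀ ℝ) +
    (heightLin b (P.root ω) + 1) • LinearMap.snd ℝ V₀ ℝ

theorem affHeight_apply (b : P.Base) (ω : ι) (v : V₀ × ℝ) :
    affHeight b ω v = heightLin b v.1 + (heightLin b (P.root ω) + 1) * v.2 := rfl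

theorem affHeight_simple {b : P.Base} {ω : ι} {a : V₀ × ℝ} (ha : a ∈ simpleRoots b ω) :
    affHeight b ω a = 1 := by
  rcases simpleRoots_cases ha with ⟨i, hi, rfl⟩ | rfl
  · simp [affHeight_apply, incl, heightLin_simple hi]
  · simp [affHeight_apply, incl, delta]

section Highest

variable {b : P.Base} {ω : ι} (hω : IsHighestRoot b ω)

include hω

theorem IsHighestRoot.heightLin_le (i : ι) :
    heightLin b (P.root i) ≤ heightLin b (P.root ω) := by
  have := (heightLin_nonneg (hω i)).1
  rw [map_sub] at this
  linarith

theorem IsHighestRoot.neg_le_heightLin (i : ι) :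
    -heightLin b (P.root ω) ≤ heightLin b (P.root i) := by
  obtain ⟨j, hj⟩ := exists_root_neg (P := P) i
  have := hω.heightLin_le j
  rw [hj, map_neg] at this
  linarith

theorem IsHighestRoot.heightLin_pos : 0 < heightLin b (P.root ω) := by
  have := hω.neg_le_heightLin ω
  exact lt_of_le_of_ne (by linarith) (heightLin_root_ne_zero b ω).symm

theorem IsHighestRoot.eq_of_le {i : ι} (h : heightLin b (P.root ω) ≤ heightLin b (P.root i)) :
    P.root i = P.root ω := by
  have h' := heightLin_nonneg (hω i)
  rw [map_sub] at h'
  exact (sub_eq_zero.mp (h'.2 (by linarith [h'.1]))).symm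

/-- Finite heights are bounded by `ht(ω)`, less than the height `ht(ω) + 1` of `δ`, so the level `n`
decides the sign unless it vanishes. -/
theorem affHeight_pos_iff {i : ι} {n : ℤ} :
    0 < affHeight b ω (P.root i, (n : ℝ)) ↔
      0 < n ∨ n = 0 ∧ 0 < heightLin b (P.root i) := by
  rw [affHeight_apply]
  have h1 := hω.heightLin_le i
  have h2 := hω.neg_le_heightLin i
  have h3 := hω.heightLin_pos
  dsimp only
  rcases lt_trichotomy n 0 with hn | rfl | hn
  · have : (n : ℝ) ≤ -1 := by exact_mod_cast Int.le_sub_one_of_lt hn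
    refine iff_of_false (not_lt.mpr ?_) (by omega)
    nlinarith
  · simp
  · have : (1 : ℝ) ≤ n := by exact_mod_cast hn
    refine iff_of_true ?_ (Or.inl hn)
    nlinarith

/-- Reflecting `ω` in a simple root cannot raise its height. -/
theorem inner_root_highest_nonneg
    (hP : ∀ (i : ι) (x y : V₀), inner ℝ (P.reflection i x) (P.reflection i y) = inner ℝ x y)
    {i : ι} (hi : i ∈ b.support) : 0 ≤ ⟪P.root i, P.root ω⟫ := by
  have h := hω.heightLin_le (P.reflectionPerm i ω)
  rw [P.root_reflectionPerm, P.reflection_apply, map_sub, map_smul, heightLin_simple hi,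
    smul_eq_mul, mul_one] at h
  have h2 := coroot'_mul_inner_self hP i (P.root ω)
  have h3 := inner_root_self_pos (P := P) i
  have : 0 ≤ P.coroot' i (P.root ω) * ⟪P.root i, P.root i⟫ := by
    refine mul_nonneg ?_ h3.le
    linarith
  rw [real_inner_comm]
  linarith

theorem coroot'_highest_nonneg
    (hP : ∀ (i : ι) (x y : V₀), inner ℝ (P.reflection i x) (P.reflection i y) = inner ℝ x y)
    {i : ι} (hi : 0 < heightLin b (P.root i)) : 0 ≤ P.coroot' ω (P.root i) := by
  rw [← coroot'_eq hP]
  have := inner_nonneg_of_mem_closure (root_mem_closure_of_pos hi)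
    fun i hi => inner_root_highest_nonneg hω hP hi
  have := inner_root_self_pos (P := P) ω
  positivity

/-- Otherwise `s_ω` would send the root below `-ω` in height. -/
theorem root_eq_highest_of_two_le {i : ι} (h : 2 ≤ P.coroot' ω (P.root i)) :
    P.root i = P.root ω := by
  refine hω.eq_of_le ?_
  have h1 := hω.neg_le_heightLin (P.reflectionPerm ω i)
  rw [P.root_reflectionPerm, P.reflection_apply, map_sub, map_smul, smul_eq_mul] at h1
  have := hω.heightLin_pos
  nlinarith

end Highest

theorem isSimpleSystem_simpleRoots [Finite ι] [P.IsCrystallographic] [P.IsReduced]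
    (hP : ∀ (i : ι) (x y : V₀), inner ℝ (P.reflection i x) (P.reflection i y) = inner ℝ x y)
    {b : P.Base} {ω : ι} (hω : IsHighestRoot b ω) :
    IsSimpleSystem (simpleRoots b ω) (affRoots P) (affHeight b ω) where
  subset := by
    intro a ha
    rcases simpleRoots_cases ha with ⟨i, -, rfl⟩ | rfl
    · exact ⟨⟨i, rfl⟩, 0, by simp [incl]⟩
    · obtain ⟨j, hj⟩ := exists_root_neg (P := P) ω
      exact ⟨⟨j, by simp [hj, delta, incl]⟩, 1, by simp [delta, incl]⟩
  neg_mem := by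
    rintro β ⟨⟨i, hi⟩, n, hn⟩
    obtain ⟨j, hj⟩ := exists_root_neg (P := P) i
    exact ⟨⟨j, by rw [hj, hi]; rfl⟩, -n, by simp [hn]⟩
  refl_mem := by
    rintro a ha ⟨_, _⟩ ⟨⟨i, rfl⟩, n, rfl⟩
    rcases simpleRoots_cases ha with ⟨j, -, rfl⟩ | rfl
    · rw [refl_incl hP]
      exact ⟨⟨_, P.root_reflectionPerm j i⟩, n, rfl⟩
    · rw [refl_delta_sub_incl hP]
      obtain ⟨z, hz⟩ := exists_int_coroot' (P := P) ω i
      exact ⟨⟨_, P.root_reflectionPerm ω i⟩, n + z, by simp only [hz]; push_cast; rfl⟩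
  form_self_pos := by
    intro a ha
    rcases simpleRoots_cases ha with ⟨i, -, rfl⟩ | rfl
    · exact inner_root_self_pos i
    · have := inner_root_self_pos (P := P) ω
      simpa [delta, incl] using this
  height_simple := fun a ha => affHeight_simple ha
  height_int := by
    rintro ⟨_, _⟩ ⟨⟨i, rfl⟩, n, rfl⟩
    refine ⟨b.height i + (b.height ω + 1) * n, ?_⟩
    rw [affHeight_apply, heightLin_root, heightLin_root]
    push_cast
    rfl
  height_ne_zero := by
    rintro ⟨_, _⟩ ⟨⟨i, rfl⟩, n, rfl⟩ h
    obtain ⟨j, hj⟩ := exists_root_neg (P := P) i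
    have h1 := affHeight_pos_iff hω (i := i) (n := n)
    have h2 := affHeight_pos_iff hω (i := j) (n := -n)
    have he : affHeight b ω (P.root j, ((-n : ℤ) : ℝ)) = 0 := by
      rw [← neg_eq_zero, ← map_neg, ← h, hj]
      simp
    rw [he, hj, map_neg] at h2
    rw [h] at h1
    have h3 := heightLin_root_ne_zero b i
    simp only [lt_irrefl, false_iff, not_or, not_and, not_lt] at h1 h2
    have hn : n = 0 := by omega
    have h4 := h1.2 hn
    have h5 := h2.2 (by omega)
    exact h3 (by linarith)
  height_refl_pos := by
    rintro a ha ⟨_, _⟩ ⟨⟨i, rfl⟩, n, rfl⟩ hp hne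
    rw [affHeight_pos_iff hω] at hp
    rcases simpleRoots_cases ha with ⟨j, hj, rfl⟩ | rfl
    · rw [refl_incl hP]
      dsimp only
      rw [← P.root_reflectionPerm, affHeight_pos_iff hω]
      refine hp.imp id fun ⟨hn, hi⟩ => ⟨hn, ?_⟩
      rw [← isPos_iff_heightLin] at hi ⊢
      refine hi.reflectionPerm hj ?_
      rintro rfl
      exact hne (by simp [incl, hn])
    · obtain ⟨z, hz⟩ := exists_int_coroot' (P := P) ω i
      rw [refl_delta_sub_incl hP]
      dsimp only
      rw [hz, ← Int.cast_add, ← P.root_reflectionPerm, affHeight_pos_iff hω,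
        P.root_reflectionPerm, P.reflection_apply]
      rw [hz]
      -- The level changes by `z`, the pairing of the root with the coroot of `ω`. At positive
      -- level, `z ≤ -2` only for the finite part `-ω`, where `n = 1` is the excluded root `δ - ω`.
      -- If `z = -1` and `n = 1`, the new finite part is the root `α + ω`, whose height is
      -- nonnegative and nonzero. At level `0`, `z ≥ 0` because `ω` is dominant.
      rcases hp with hn | ⟨rfl, hi⟩
      · obtain ⟨j, hj⟩ := exists_root_neg (P := P) i
        by_cases hj2 : (2 : ℝ) ≤ P.coroot' ω (P.root j)
        · have h1 := root_eq_highest_of_two_le hω hj2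
          have h2 : P.root i = -P.root ω := by rw [← h1, hj, neg_neg]
          have h3 : z = -2 := by
            rw [h2, map_neg, show P.coroot' ω (P.root ω) = 2 from P.root_coroot_two ω] at hz
            exact_mod_cast hz.symm
          rcases (by omega : n = 1 ∨ n = 2 ∨ 2 < n) with rfl | rfl | hn2
          · exact absurd (by ext <;> simp [h2, delta, incl]) hne
          · right
            refine ⟨by omega, ?_⟩
            have := hω.heightLin_pos
            rw [h2, h3, map_sub, map_smul, map_neg, smul_eq_mul]
            push_cast
            linarith
          · left
            omega
        · have h1 : -1 ≤ z := by
            have : P.coroot' ω (P.root j) = -z := by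
              rw [hj, map_neg, hz]
            rw [this, not_le] at hj2
            have : (-2 : ℝ) < z := by linarith
            have : (-2 : ℤ) < z := by exact_mod_cast this
            omega
          rcases (by omega : 0 < n + z ∨ n + z = 0 ∧ z = -1) with h | ⟨h, h2⟩
          · exact Or.inl h
          · right
            refine ⟨h, ?_⟩
            have h3 : P.root i - (z : ℝ) • P.root ω = P.root (P.reflectionPerm ω i) := by
              rw [P.root_reflectionPerm, P.reflection_apply, hz]
            have h4 := heightLin_root_ne_zero b (P.reflectionPerm ω i)
            have h5 := hω.neg_le_heightLin i
            refine lt_of_le_of_ne ?_ (by rw [h3]; exact h4.symm)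
            rw [h2, map_sub, map_smul, smul_eq_mul]
            push_cast
            linarith
      · have h1 : (0 : ℝ) ≤ z := by
          rw [← hz]
          exact coroot'_highest_nonneg hω hP hi
        have h1 : 0 ≤ z := by exact_mod_cast h1
        rcases h1.eq_or_lt with rfl | h1
        · right
          simpa using hi
        · left
          omega
  exists_form_pos := by
    rintro ⟨_, _⟩ ⟨⟨i, rfl⟩, n, rfl⟩ -
    -- If no simple root pairs positively with `nδ + α`, then `-α` is dominant and `⟪α, ω⟫ ≥ 0`.
    -- Pairing `-α` with `α` if `α` is positive, and with `ω + α` otherwise, contradicts `⟪α, α⟫ >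
    -- 0`.
    by_contra! hcon
    have h1 : ∀ j ∈ b.support, 0 ≤ ⟪P.root j, -P.root i⟫ := by
      intro j hj
      have := hcon _ (Or.inl ⟨j, hj, rfl⟩)
      rw [form_apply, real_inner_comm] at this
      rw [inner_neg_right]
      exact neg_nonneg.mpr this
    have h2 : 0 ≤ ⟪P.root i, P.root ω⟫ := by
      have := hcon _ (Or.inr rfl)
      simpa [delta, incl] using this
    have h3 := inner_root_self_pos (P := P) i
    rcases b.root_mem_or_neg_mem i with hi | hi
    · have := inner_nonneg_of_mem_closure hi h1
      rw [inner_neg_right] at this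
      linarith
    · obtain ⟨j, hj⟩ := exists_root_neg (P := P) i
      have := inner_nonneg_of_mem_closure (hω j) h1
      rw [hj, inner_neg_right, sub_neg_eq_add, inner_add_left, real_inner_comm] at this
      linarith

theorem mem_affPosRoots_iff {b : P.Base} {ω : ι} (hω : IsHighestRoot b ω) {v : V₀ × ℝ} :
    v ∈ affPosRoots b ↔ v ∈ affRoots P ∧ 0 < affHeight b ω v := by
  constructor
  · rintro ⟨k, _, ⟨i, hi, rfl⟩, rfl | rfl⟩
    · have he : (k : ℝ) • delta + incl (P.root i) = (P.root i, ((k : ℤ) : ℝ)) := by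
        simp [delta, incl]
      rw [he, affHeight_pos_iff hω]
      refine ⟨⟨⟨i, rfl⟩, k, rfl⟩, ?_⟩
      have := isPos_iff_heightLin.mp hi
      rcases k.eq_zero_or_pos with rfl | hk
      · exact Or.inr ⟨rfl, this⟩
      · exact Or.inl (by exact_mod_cast hk)
    · obtain ⟨j, hj⟩ := exists_root_neg (P := P) i
      have he : ((k : ℝ) + 1) • delta - incl (P.root i) = (P.root j, ((k + 1 : ℤ) : ℝ)) := by
        simp [delta, incl, hj]
      rw [he, affHeight_pos_iff hω]
      exact ⟨⟨⟨j, rfl⟩, _, rfl⟩, Or.inl (by omega)⟩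
  · obtain ⟨x, t⟩ := v
    rintro ⟨⟨⟨i, rfl⟩, n, rfl⟩, h⟩
    rw [affHeight_pos_iff hω] at h
    by_cases hi : 0 < heightLin b (P.root i)
    · obtain ⟨k, rfl⟩ : ∃ k : ℕ, n = k := Int.eq_ofNat_of_zero_le (by omega)
      exact ⟨k, _, ⟨i, isPos_iff_heightLin.mpr hi, rfl⟩, Or.inl (by simp [delta, incl])⟩
    · obtain ⟨k, hk⟩ : ∃ k : ℕ, n - 1 = k := Int.eq_ofNat_of_zero_le (by
        rcases h with h | h
        · omega
        · exact absurd h.2 hi)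
      obtain ⟨j, hj⟩ := exists_root_neg (P := P) i
      have hne := heightLin_root_ne_zero b i
      have hn : n = k + 1 := by omega
      refine ⟨k, P.root j, ⟨j, isPos_iff_heightLin.mpr ?_, rfl⟩, Or.inr ?_⟩
      · rw [hj, map_neg]
        exact neg_pos.mpr (lt_of_le_of_ne (not_lt.mp hi) hne)
      · simp [delta, incl, hj, hn]

end AffineSystem

/-! ### Depth and the root order in terms of upward steps -/

section Order

variable {ι V₀ N : Type*} [NormedAddCommGroup V₀] [InnerProductSpace ℝ V₀]
  [AddCommGroup N] [Module ℝ N] {P : RootPairing ι ℝ V₀ N}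

theorem word_mem_affWeyl {b : P.Base} {ω : ι} {l : List (V₀ × ℝ)}
    (hl : ∀ a ∈ l, a ∈ simpleRoots b ω) : word l ∈ affWeyl b ω := by
  refine Subgroup.list_prod_mem _ fun s hs => ?_
  obtain ⟨a, ha, rfl⟩ := List.mem_map.mp hs
  exact Subgroup.subset_closure ⟨a, hl a ha, rfl⟩

theorem length_word_le {b : P.Base} {ω : ι} {l : List (V₀ × ℝ)}
    (hl : ∀ a ∈ l, a ∈ simpleRoots b ω) :
    length b ω ⟨word l, word_mem_affWeyl hl⟩ ≤ l.length := by
  refine Nat.sInf_le ⟨l.map refl, fun s hs => ?_, rfl, List.length_map _⟩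
  obtain ⟨a, ha, rfl⟩ := List.mem_map.mp hs
  exact ⟨a, hl a ha, rfl⟩

theorem exists_word_eq (b : P.Base) (ω : ι) (w : affWeyl b ω) :
    ∃ l : List (V₀ × ℝ), (∀ a ∈ l, a ∈ simpleRoots b ω) ∧ word l = w ∧
      l.length = length b ω w := by
  obtain ⟨l, hl, hp, hn⟩ := exists_word b ω w
  obtain ⟨l', h1, h2⟩ : ∃ l' : List (V₀ × ℝ), (∀ a ∈ l', a ∈ simpleRoots b ω) ∧
      l'.map refl = l := by
    clear hp hn
    induction l with
    | nil => exact ⟨[], by simp, rfl⟩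
    | cons s l ih =>
      obtain ⟨l', h1, h2⟩ := ih fun s hs => hl s (List.mem_cons_of_mem _ hs)
      obtain ⟨a, ha, rfl⟩ := hl s List.mem_cons_self
      refine ⟨a :: l', fun c hc => ?_, by simp [h2]⟩
      rcases List.mem_cons.mp hc with rfl | hc
      exacts [ha, h1 c hc]
  exact ⟨l', h1, by rw [word, h2, hp], by rw [← hn, ← h2, List.length_map]⟩

/-- A shortest word making `β` negative reaches a simple root just before its last reflection;
conversely, one more reflection negates a simple root. -/
theorem depth_add_one {b : P.Base} {ω : ι} {R : Set (V₀ × ℝ)} {H : (V₀ × ℝ) →ₗ[ℝ] ℝ}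
    (hS : IsSimpleSystem (simpleRoots b ω) R H) {β : V₀ × ℝ} (hβ : β ∈ R) (hp : 0 < H β) :
    depth b ω β + 1 = signDepth (simpleRoots b ω) H β := by
  obtain ⟨c, hc, l, hl, hlc, hn⟩ := hS.exists_cons_word_signDepth hβ hp
  have hmem : length b ω ⟨word l, word_mem_affWeyl hl⟩ ∈
      {n | ∃ w : affWeyl b ω, w.1 β ∈ simpleRoots b ω ∧ length b ω w = n} :=
    ⟨⟨word l, word_mem_affWeyl hl⟩, by rw [hlc]; exact hc, rfl⟩
  have h1 : depth b ω β ≤ _ := Nat.sInf_le hmem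
  have h2 := length_word_le hl
  obtain ⟨w, hw, hd⟩ := Nat.sInf_mem ⟨_, hmem⟩
  obtain ⟨l', hl', hlw, hn'⟩ := exists_word_eq b ω w
  have hcons : ∀ a ∈ w.1 β :: l', a ∈ simpleRoots b ω := by
    intro a ha
    rcases List.mem_cons.mp ha with rfl | ha
    exacts [hw, hl' a ha]
  have h3 := signDepth_le (H := H) (β := β) hcons (mul_neg_of_neg_of_pos (by
    rw [word_cons, hlw, refl_self (hS.form_self_pos _ hw).ne', map_neg, hS.height_simple _ hw]
    norm_num) hp)
  rw [List.length_cons, hn', hd] at h3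
  change _ ≤ depth b ω β + 1 at h3
  omega

/-- The root poset is the reflexive transitive closure of the upward steps. -/
theorem le_iff_reflTransGen {b : P.Base} {ω : ι} {R : Set (V₀ × ℝ)} {H : (V₀ × ℝ) →ₗ[ℝ] ℝ}
    (hS : IsSimpleSystem (simpleRoots b ω) R H)
    (hR : ∀ v, v ∈ affPosRoots b ↔ v ∈ R ∧ 0 < H v) (x y : PosRoot b ω) :
    x ≤ y ↔ Relation.ReflTransGen (Up (simpleRoots b ω)) x.1 y.1 := by
  obtain ⟨hx, hxp⟩ := (hR _).mp x.2
  constructor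
  · rintro ⟨w, hw, hn⟩
    obtain ⟨hy, hyp⟩ := (hR _).mp y.2
    obtain ⟨l, hl, hlw, hll⟩ := exists_word_eq b ω w
    rw [← hlw] at hw
    rw [← hw] at hy hyp hn ⊢
    refine hS.reflTransGen_of_signDepth_word hl hx hyp ?_
    rw [← depth_add_one hS hx hxp, ← depth_add_one hS hy hyp]
    omega
  · intro h
    obtain ⟨y, hy⟩ := y
    dsimp only at h
    induction h with
    | refl => exact le_refl x
    | @tail β _ hc hu ih =>
      obtain ⟨h1, h2⟩ := hS.reflTransGen_mem_pos hc hx hxp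
      have hle : x ≤ ⟨β, (hR β).mpr ⟨h1, h2⟩⟩ := ih _
      refine hle.trans ?_
      obtain ⟨a, ha, hf, rfl⟩ := hu
      have hl : ∀ c ∈ [a], c ∈ simpleRoots b ω := by simpa using ha
      have h3 := hS.up_mem_pos ⟨a, ha, hf, rfl⟩ h1 h2
      -- The length is at most one, and at least one because the depth rises by one.
      have h4 := length_word_le hl
      have h5 := depth_apply_le b ω ⟨word [a], word_mem_affWeyl hl⟩ β
      have h6 := hS.signDepth_up ha h1 h2 hf
      rw [← depth_add_one hS h1 h2, ← depth_add_one hS h3.1 h3.2] at h6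
      refine ⟨⟨word [a], word_mem_affWeyl hl⟩, rfl, ?_⟩
      change depth b ω (refl a β) ≤ _ at h5
      rw [List.length_singleton] at h4
      dsimp only
      omega

end Order

/-! ### Slices: translation, convexity and short coverings -/

section Slice

variable {ι V₀ N : Type*} [NormedAddCommGroup V₀] [InnerProductSpace ℝ V₀]
  [AddCommGroup N] [Module ℝ N] {P : RootPairing ι ℝ V₀ N} {b : P.Base} {ω : ι} {O : Set V₀}

theorem exists_shift_of_mem_slice {k : ℕ} {x : PosRoot b ω} (hx : x ∈ slice b ω O k) (m : ℕ) :
    ∃ α ∈ posPart b O, x.1 + ((m : ℝ) - k) • delta = (m : ℝ) • delta + incl α ∨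
      x.1 + ((m : ℝ) - k) • delta = ((m : ℝ) + 1) • delta - incl α := by
  obtain ⟨α, hα, h | h⟩ := hx
  · exact ⟨α, hα, Or.inl (by rw [h]; module)⟩
  · exact ⟨α, hα, Or.inr (by rw [h]; module)⟩

/-- The translation by `(m - k)δ` from the slice `k` to the slice `m`. -/
def sliceShift (k m : ℕ) (x : slice b ω O k) : slice b ω O m :=
  ⟨⟨x.1.1 + ((m : ℝ) - k) • delta, by
    obtain ⟨α, hα, h⟩ := exists_shift_of_mem_slice x.2 m
    exact ⟨m, α, hα.2, h⟩⟩, exists_shift_of_mem_slice x.2 m⟩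

theorem sliceShift_val (k m : ℕ) (x : slice b ω O k) :
    (sliceShift k m x).1.1 = x.1.1 + ((m : ℝ) - k) • delta := rfl

theorem sliceShift_sliceShift (k m : ℕ) (x : slice b ω O k) :
    sliceShift m k (sliceShift k m x) = x := by
  refine Subtype.ext (Subtype.ext ?_)
  rw [sliceShift_val, sliceShift_val]
  module

theorem orbit_reflection_mem (hO : ∃ i : ι, O = MulAction.orbit P.weylGroup (P.root i))
    (i : ι) {v : V₀} (hv : v ∈ O) : P.reflection i v ∈ O := by
  obtain ⟨j, rfl⟩ := hO
  exact MulAction.mem_orbit_of_mem_orbit (RootPairing.weylGroup.ofIdx P i) hv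

theorem orbit_subset_range (hO : ∃ i : ι, O = MulAction.orbit P.weylGroup (P.root i)) :
    O ⊆ Set.range P.root := by
  obtain ⟨j, rfl⟩ := hO
  rintro _ ⟨g, rfl⟩
  exact ⟨_, (P.weylGroup_apply_root g j).symm⟩

theorem orbit_neg_mem (hO : ∃ i : ι, O = MulAction.orbit P.weylGroup (P.root i))
    {v : V₀} (hv : v ∈ O) : -v ∈ O := by
  obtain ⟨i, rfl⟩ := orbit_subset_range hO hv
  rw [← P.reflection_apply_self]
  exact orbit_reflection_mem hO i hv

theorem reflTransGen_fst_mem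
    (hP : ∀ (i : ι) (x y : V₀), inner ℝ (P.reflection i x) (P.reflection i y) = inner ℝ x y)
    (hO : ∃ i : ι, O = MulAction.orbit P.weylGroup (P.root i)) {β γ : V₀ × ℝ}
    (h : Relation.ReflTransGen (Up (simpleRoots b ω)) β γ) (hβ : β.1 ∈ O) : γ.1 ∈ O := by
  induction h with
  | refl => exact hβ
  | tail _ hu ih =>
    obtain ⟨a, ha, -, rfl⟩ := hu
    obtain ⟨i, hi⟩ := exists_refl_fst hP ha
    rw [hi]
    exact orbit_reflection_mem hO i ih

variable [P.IsRootSystem]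

theorem affHeight_bounds (hω : IsHighestRoot b ω) {k : ℕ} {α : V₀} (hα : α ∈ finPosRoots b)
    {v : V₀ × ℝ}
    (hv : v = (k : ℝ) • delta + incl α ∨ v = ((k : ℝ) + 1) • delta - incl α) :
    k * (heightLin b (P.root ω) + 1) < affHeight b ω v ∧
      affHeight b ω v < (k + 1) * (heightLin b (P.root ω) + 1) := by
  obtain ⟨i, hi, rfl⟩ := hα
  have h1 := isPos_iff_heightLin.mp hi
  have h2 := hω.heightLin_le i
  rcases hv with rfl | rfl
  · simp only [affHeight_apply, delta, incl, Prod.fst_add, Prod.smul_fst, Prod.snd_add,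
      Prod.smul_snd, smul_zero, zero_add, smul_eq_mul, mul_one, add_zero]
    constructor <;> nlinarith
  · simp only [affHeight_apply, delta, incl, Prod.fst_sub, Prod.smul_fst, Prod.snd_sub,
      Prod.smul_snd, smul_zero, zero_sub, smul_eq_mul, mul_one, sub_zero, map_neg]
    constructor <;> nlinarith

/-- The height intervals of distinct levels are disjoint, so height detects the level. This makes
order-convexity of slices immediate. -/
theorem mem_slice_iff (hω : IsHighestRoot b ω)
    (hO : ∃ i : ι, O = MulAction.orbit P.weylGroup (P.root i)) {k : ℕ} {x : PosRoot b ω} :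
    x ∈ slice b ω O k ↔ x.1.1 ∈ O ∧ k * (heightLin b (P.root ω) + 1) < affHeight b ω x.1 ∧
      affHeight b ω x.1 < (k + 1) * (heightLin b (P.root ω) + 1) := by
  constructor
  · rintro ⟨α, hα, h⟩
    refine ⟨?_, affHeight_bounds hω hα.2 h⟩
    rcases h with h | h
    · simpa [h, delta, incl] using hα.1
    · simpa [h, delta, incl] using orbit_neg_mem hO hα.1
  · rintro ⟨hxO, h1, h2⟩
    obtain ⟨m, α, hα, h⟩ := x.2
    obtain ⟨h3, h4⟩ := affHeight_bounds hω hα h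
    have hpos : 0 < heightLin b (P.root ω) + 1 := by linarith [hω.heightLin_pos]
    have h5 : (k : ℝ) < m + 1 := lt_of_mul_lt_mul_right (h1.trans h4) hpos.le
    have h6 : (m : ℝ) < k + 1 := lt_of_mul_lt_mul_right (h3.trans h2) hpos.le
    have h7 : k < m + 1 := by exact_mod_cast h5
    have h8 : m < k + 1 := by exact_mod_cast h6
    obtain rfl : m = k := by omega
    refine ⟨α, ⟨?_, hα⟩, h⟩
    rcases h with h | h
    · simpa [h, delta, incl] using hxO
    · simpa [h, delta, incl] using orbit_neg_mem hO hxO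

/-- An upward step within a slice is short. -/
theorem neg_len_mul_len_lt_form [Finite ι] [P.IsCrystallographic] [P.IsReduced]
    (hP : ∀ (i : ι) (x y : V₀), inner ℝ (P.reflection i x) (P.reflection i y) = inner ℝ x y)
    (hω : IsHighestRoot b ω) {k : ℕ} {a β : V₀ × ℝ} (ha : a ∈ simpleRoots b ω)
    (hβ : β ∈ affRoots P) (hf : form β a < 0)
    (h1 : k * (heightLin b (P.root ω) + 1) < affHeight b ω β)
    (h2 : affHeight b ω (refl a β) < (k + 1) * (heightLin b (P.root ω) + 1)) :
    -(len β * len a) < form β a := by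
  have hS := isSimpleSystem_simpleRoots hP hω
  have hlen : ∀ x : V₀ × ℝ, len x = ‖x.1‖ := fun x => (norm_eq_sqrt_real_inner x.1).symm
  rw [hlen, hlen]
  -- Cauchy–Schwarz gives the weak inequality; equality makes the finite parts proportional, hence
  -- opposite by reducedness.
  refine lt_of_le_of_ne (neg_le_of_abs_le (abs_real_inner_le_norm β.1 a.1)) fun he => ?_
  obtain ⟨⟨i, hi⟩, n, hn⟩ := hβ
  obtain ⟨⟨j, hj⟩, m, hm⟩ := hS.subset ha
  rw [form_apply] at he hf
  have hdep : ‖a.1‖ • β.1 + ‖β.1‖ • a.1 = 0 := by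
    have := inner_eq_norm_mul_iff_real.mp
      (show ⟪-β.1, a.1⟫ = ‖-β.1‖ * ‖a.1‖ by rw [inner_neg_left, norm_neg, ← he, neg_neg])
    rw [norm_neg, smul_neg] at this
    rw [← this, add_neg_cancel]
  have hopp : β.1 = -a.1 := by
    have hli : ¬ LinearIndependent ℝ ![P.root i, P.root j] := by
      intro h
      rw [hi, hj, LinearIndependent.pair_iff] at h
      have := (h _ _ hdep).2
      rw [norm_eq_zero, ← hi] at this
      exact P.ne_zero i this
    rcases RootPairing.IsReduced.eq_or_eq_neg i j hli with h | h
    · rw [hi, hj] at h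
      rw [h] at hf
      exact absurd real_inner_self_nonneg (not_le.mpr hf)
    · rwa [hi, hj] at h
  have haa := hS.form_self_pos a ha
  have hc : 2 * form β a / form a a = -2 := by
    rw [div_eq_iff haa.ne', form_apply, form_apply, hopp, inner_neg_left]
    ring
  have hpos : 0 < heightLin b (P.root ω) + 1 := by linarith [hω.heightLin_pos]
  -- Now `β + a = (n + m)δ` and `s_a(β) = β + 2a`. The height of `β + a` lies between theirs,
  -- forcing the integer `n + m` strictly between `k` and `k + 1`.
  have hsum : affHeight b ω β + affHeight b ω a = (n + m) * (heightLin b (P.root ω) + 1) := by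
    rw [← map_add, affHeight_apply, Prod.fst_add, hopp, Prod.snd_add,
      hn, hm, neg_add_cancel, map_zero]
    ring
  rw [hS.height_simple a ha] at hsum
  rw [hS.height_refl ha, hc] at h2
  have h3 : (k : ℝ) < n + m := by
    refine lt_of_mul_lt_mul_right ?_ hpos.le
    rw [← hsum]
    linarith
  have h4 : (n + m : ℝ) < k + 1 := by
    refine lt_of_mul_lt_mul_right ?_ hpos.le
    rw [← hsum]
    linarith
  have h3 : (k : ℤ) < n + m := by exact_mod_cast h3
  have h4 : n + m < (k : ℤ) + 1 := by exact_mod_cast h4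
  omega

/-- The translation by `-kδ` is an isomorphism from the slice `k` to the slice `0`. -/
theorem exists_slice_orderIso [Finite ι] [P.IsCrystallographic] [P.IsReduced]
    (hP : ∀ (i : ι) (x y : V₀), inner ℝ (P.reflection i x) (P.reflection i y) = inner ℝ x y)
    (hω : IsHighestRoot b ω) (k : ℕ) :
    ∃ π : slice b ω O k ≃o slice b ω O 0, ∀ α ∈ posPart b O, ∀ x : slice b ω O k,
      (x.1.1 = (k : ℝ) • delta + incl α → (π x).1.1 = incl α) ∧
      (x.1.1 = ((k : ℝ) + 1) • delta - incl α → (π x).1.1 = delta - incl α) := by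
  have hS := isSimpleSystem_simpleRoots hP hω
  have hR := fun v => mem_affPosRoots_iff hω (v := v)
  have hle := le_iff_reflTransGen hS hR
  refine ⟨⟨⟨sliceShift k 0, sliceShift 0 k, sliceShift_sliceShift k 0,
    sliceShift_sliceShift 0 k⟩, ?_⟩, ?_⟩
  · intro x y
    change (sliceShift k 0 x).1 ≤ (sliceShift k 0 y).1 ↔ x.1 ≤ y.1
    rw [hle, hle, sliceShift_val, sliceShift_val]
    refine ⟨fun h => ?_, fun h => reflTransGen_add_smul_delta h _⟩
    have := reflTransGen_add_smul_delta h (-(((0 : ℕ) : ℝ) - k))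
    simpa only [add_assoc, ← add_smul, add_neg_cancel, zero_smul, add_zero] using this
  · intro α _ x
    change (_ → (sliceShift k 0 x).1.1 = _) ∧ (_ → (sliceShift k 0 x).1.1 = _)
    rw [sliceShift_val]
    refine ⟨fun h => ?_, fun h => ?_⟩ <;>
    · rw [h, Nat.cast_zero]
      module

theorem isShortCovering_of_slice_covBy [Finite ι] [P.IsCrystallographic] [P.IsReduced]
    (hP : ∀ (i : ι) (x y : V₀), inner ℝ (P.reflection i x) (P.reflection i y) = inner ℝ x y)
    (hω : IsHighestRoot b ω)
    (hO : ∃ i : ι, O = MulAction.orbit P.weylGroup (P.root i)) {k : ℕ} {β γ : slice b ω O k}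
    (hcov : β ⋖ γ) : IsShortCovering β.1 γ.1 := by
  have hS := isSimpleSystem_simpleRoots hP hω
  have hR := fun v => mem_affPosRoots_iff hω (v := v)
  have hle := le_iff_reflTransGen hS hR
  have hslice : ∀ x : PosRoot b ω, β.1 ≤ x → x ≤ γ.1 → x ∈ slice b ω O k := by
    intro x h1 h2
    rw [hle] at h1 h2
    obtain ⟨hβO, hβl, -⟩ := (mem_slice_iff hω hO).mp β.2
    obtain ⟨-, -, hγu⟩ := (mem_slice_iff hω hO).mp γ.2
    exact (mem_slice_iff hω hO).mpr ⟨reflTransGen_fst_mem hP hO h1 hβO,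
      hβl.trans_le (hS.height_le_of_reflTransGen h1),
      (hS.height_le_of_reflTransGen h2).trans_lt hγu⟩
  have hcov' : β.1 ⋖ γ.1 := by
    refine ⟨hcov.1, fun x h1 h2 => ?_⟩
    exact hcov.2 (c := ⟨x, hslice x h1.le h2.le⟩) h1 h2
  refine ⟨hcov', ?_⟩
  obtain ⟨hβR, hβp⟩ := (hR _).mp β.1.2
  -- The first upward step towards `γ` already lands in the interval from `β` to `γ`, so it ends at
  -- `γ`.
  rcases ((hle _ _).mp hcov'.1.le).cases_head with h | ⟨c, hu, hc⟩
  · exact absurd (Subtype.ext h) hcov'.1.ne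
  · have hlt := hS.height_lt_of_up hu
    obtain ⟨x, rfl⟩ : ∃ x : PosRoot b ω, x.1 = c :=
      ⟨⟨c, (hR c).mpr (hS.up_mem_pos hu hβR hβp)⟩, rfl⟩
    rcases hcov'.eq_or_eq ((hle β.1 x).mpr (Relation.ReflTransGen.single hu))
      ((hle x γ.1).mpr hc) with rfl | rfl
    · exact absurd hlt (lt_irrefl _)
    · obtain ⟨a, ha, hf, he⟩ := hu
      obtain ⟨-, hβl, -⟩ := (mem_slice_iff hω hO).mp β.2
      obtain ⟨-, -, hγu⟩ := (mem_slice_iff hω hO).mp γ.2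
      rw [he] at hγu
      exact ⟨a, ha, he.symm, neg_len_mul_len_lt_form hP hω ha hβR hf hβl hγu, hf⟩

end Slice

end AffineRoot

theorem mainTheorem5 {ι V₀ N : Type*} [Finite ι]
    [NormedAddCommGroup V₀] [InnerProductSpace ℝ V₀] [AddCommGroup N] [Module ℝ N]
    (P : RootPairing ι ℝ V₀ N) [P.IsRootSystem] [P.IsCrystallographic] [P.IsReduced]
    [P.IsIrreducible]
    (hP : ∀ (i : ι) (x y : V₀), inner ℝ (P.reflection i x) (P.reflection i y) = inner ℝ x y)
    (b : P.Base) (ω : ι) (hω : AffineRoot.IsHighestRoot b ω)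
    (O : Set V₀) (hO : ∃ i : ι, O = MulAction.orbit P.weylGroup (P.root i)) (k : ℕ) :
    (∃ π : AffineRoot.slice b ω O k ≃o AffineRoot.slice b ω O 0,
      ∀ α ∈ AffineRoot.posPart b O, ∀ x : AffineRoot.slice b ω O k,
        (x.1.1 = (k : ℝ) • AffineRoot.delta + AffineRoot.incl α →
          (π x).1.1 = AffineRoot.incl α) ∧
        (x.1.1 = ((k : ℝ) + 1) • AffineRoot.delta - AffineRoot.incl α →
          (π x).1.1 = AffineRoot.delta - AffineRoot.incl α)) ∧
    ∀ β γ : AffineRoot.slice b ω O k, β ⋖ γ → AffineRoot.IsShortCovering β.1 γ.1 :=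
  ⟨AffineRoot.exists_slice_orderIso hP hω k,
    fun _ _ h => AffineRoot.isShortCovering_of_slice_covBy hP hω hO h⟩
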